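/- Let $\mathbf K=(K,+,\cdot,0,1)$ be a semiring (with $0$ absorbing, $\cdot$ not necessarily commutative). A matrix $A\in K^{n\times n}$ is \emph{synchronizing} if there is a column index $i$ such that for all $j,k$ we have $A_{j,k}\neq 0$ if and only if $k=i$, and all the entries $A_{j,i}$, $1\le j\le n$, of that column are equal. A finite set $\mathcal M\subseteq K^{n\times n}$ is \emph{synchronizable} if some product $M_1M_2\cdots M_t$ with $t>0$ and $M_1,\dots,M_t\in\mathcal M$ is synchronizing. The problem $\mathbf K$-Sync is: given $n>0$ and a finite set $\mathcal M$ of matrices in $K^{n\times n}$, decide whether $\mathcal M$ is synchronizable. Matrix entries are given to an algorithm by finite names: a representation of elements of $K$ is a partial map $\rho$ from a set of finite objects (codes) to $K$; a code in the domain of $\rho$ is a name of its image. Neither injectivity nor surjectivity nor decidability of the domain is required. We say that $\mathbf K$-Sync is decidable with respect to $\rho$ if there is an algorithm that halts with the correct answer on every input consisting of $n>0$ and a finite list of $n\times n$ matrices of names. Natural numbers are their own names. \textbf{Theorem.} \begin{enumerate} \item $\mathbf N$-Sync is undecidable, where $\mathbf N$ is the semiring of natural numbers $\{0,1,2,\dots\}$.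 \item For every semiring $\mathbf K$, the element $1$ has infinite order in $(K,+,0)$ (that is, $\{0,1,1+1,\dots\}$ is infinite) if and only if $\mathbf N$ embeds into $\mathbf K$, i.e. there is an injective semiring homomorphism $\mathbf N\to\mathbf K$. If this is the case, then $\mathbf K$-Sync is undecidable with respect to every representation of elements of $K$ in which a name of $m\cdot 1=1+\dots+1$ ($m$ summands) can be computed from $m\in\mathbf N$. \end{enumerate} -/

import Mathlib

/-- `A` is location synchronizing with designated column `i`: the nonzero entries of `A` are
exactly the entries of its column `i`. -/
def IsLocationSynchronizingAt {K : Type*} [Semiring K] {n : ℕ}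
    (A : Matrix (Fin n) (Fin n) K) (i : Fin n) : Prop :=
  ∀ j k, A j k ≠ 0 ↔ k = i

/-- `A` is synchronizing: it is location synchronizing and all the entries of its designated
column are the same. -/
def IsSynchronizing {K : Type*} [Semiring K] {n : ℕ} (A : Matrix (Fin n) (Fin n) K) : Prop :=
  ∃ i, IsLocationSynchronizingAt A i ∧ ∀ j j', A j i = A j' i

/-- A set of `n × n` matrices is synchronizable if some product `M₁ * ⋯ * Mₜ`, `t > 0`, of members
of the set is synchronizing. -/
def IsSynchronizable {K : Type*} [Semiring K] {n : ℕ}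
    (S : Set (Matrix (Fin n) (Fin n) K)) : Prop :=
  ∃ w : List (Matrix (Fin n) (Fin n) K), w ≠ [] ∧ (∀ A ∈ w, A ∈ S) ∧ IsSynchronizing w.prod

/-- The list of rows of a square matrix. -/
def matrixRows {α : Type*} {n : ℕ} (A : Matrix (Fin n) (Fin n) α) : List (List α) :=
  List.ofFn fun i => List.ofFn fun j => A i j

/-- The input word for a finite list of `n × n` matrices: the dimension, and the matrices listed
row by row. -/
def instanceCode {α : Type*} {n : ℕ} (L : List (Matrix (Fin n) (Fin n) α)) :
    ℕ × List (List (List α)) :=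
  (n, L.map matrixRows)

/-- The set of matrices over `K` that a list of matrices of names denotes, where the partial
function `ρ` sends a name to the element of `K` it denotes (if it denotes one). -/
def denotedMatrices {K α : Type*} (ρ : α →. K) {n : ℕ} (L : List (Matrix (Fin n) (Fin n) α)) :
    Set (Matrix (Fin n) (Fin n) K) :=
  {B | ∃ A ∈ L, ∀ i j, B i j ∈ ρ (A i j)}

/-- The problem `K`-Sync is decidable, when elements of `K` are given by names through the partial
function `ρ`: some algorithm halts, with the correct answer, on every nonempty dimension `n` and
every finite list of `n × n` matrices whose entries are names of elements of `K`. Nothing is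
required of the algorithm on other inputs. -/
def SyncDecidable {K α : Type*} [Semiring K] [Primcodable α] (ρ : α →. K) : Prop :=
  ∃ f : ℕ × List (List (List α)) →. Bool, Partrec f ∧
    ∀ n : ℕ, 0 < n → ∀ L : List (Matrix (Fin n) (Fin n) α),
      (∀ A ∈ L, ∀ i j, (ρ (A i j)).Dom) →
        (f (instanceCode L)).Dom ∧
          (true ∈ f (instanceCode L) ↔ IsSynchronizable (denotedMatrices ρ L))

/-- `1` has infinite order in `(K, +, 0)`: the submonoid `{0, 1, 1 + 1, …}` it generates is
infinite. -/
def OneHasInfiniteOrder (K : Type*) [Semiring K] : Prop :=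
  (AddSubmonoid.multiples (1 : K) : Set K).Infinite

/-- From a natural number `m` one can compute a name of the element `1 + ⋯ + 1` (`m` summands)
of `K`. -/
def NamesNaturals {K α : Type*} [Semiring K] [Primcodable α] (ρ : α →. K) : Prop :=
  ∃ c : ℕ → α, Computable c ∧ ∀ m : ℕ, m • (1 : K) ∈ ρ (c m)

/-!
The halting problem is reduced to synchronization of matrices over `ℕ`; an injective homomorphism
`ℕ → K` then carries the instances over to `K`.

*From computations to guessing programs.* By induction over `Nat.Partrec'`, the graph of every
partial recursive function can be verified by a nondeterministic loop program whose only
conditions are equality tests between registers (`LoopProgram.Representable.of_partrec'`). It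
suffices to *check* a value, since intermediate values can be guessed; primitive recursion and
minimization are both instances of guessing and checking a finite sequence
(`LoopProgram.Checkable.iterate`). With the number of the control state in one more coordinate,
such a program becomes a finite list of linear maps on `ℕ`-vectors `x`, each guarded by equations
`a = b` between linear forms in `x` (`LoopProgram.exists_linearRules`).

*From guards to one equation.* The maps act linearly on the vector of products `x i * x j`, so an
accumulator can sum up `a ^ 2 + b ^ 2`, and another one `2 * a * b`, over all the equations `a = b`
met on the way. The two accumulators are equal in the end exactly if all the guards are satisfied
(`LinearRule.runCross_eq_runSquares_iff`). The function thus halts on an input `n` exactly if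
some product of fixed matrices takes a row vector `u`, computed from `n`, to a vector on which two
given linear forms agree.

*From one equation to synchronization.* The matrices of the gadget act on two copies of the index
set and on a final index. One matrix starts both copies with `u`, and one moves to the final index,
by one linear form on the first copy and by the other on the second. A product can make the rows
that come from the two copies equal only if the two forms agree
(`SyncGadget.exists_hasConstantColumn_iff`).

Applied to a universal function, this makes all matrices independent of `n` but the starting one,
whose entries are products of two numbers that are constant or equal to `n`. Hence the instance is
computable from `n` as soon as a name of `m • 1` is computable from `m`.
-/

/-! ### Nondeterministic loop programs -/

namespace LoopProgram

/-- A memory state: the contents of the registers, all but finitely many of which any given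
program leaves alone. -/
abbrev State := ℕ → ℕ

/-- The elementary instructions. -/
inductive Instr
  /-- Block unless registers `i` and `j` agree. -/
  | test (i j : ℕ)
  /-- Copy register `j` into register `i`. -/
  | set (i j : ℕ)
  /-- Clear register `i`. -/
  | zero (i : ℕ)
  /-- Increment register `i`. -/
  | inc (i : ℕ)

namespace Instr

/-- The condition under which an instruction can be executed. -/
def Guard : Instr → State → Prop
  | test i j, σ => σ i = σ j
  | _, _ => True

/-- The effect of an instruction on the state. -/
def update : Instr → State → State
  | test _ _, σ => σ
  | set i j, σ => Function.update σ i (σ j)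
  | zero i, σ => Function.update σ i 0
  | inc i, σ => Function.update σ i (σ i + 1)

end Instr

/-- Nondeterministic programs: instructions, sequential composition, and execution any number of
times. -/
inductive Prog
  | op (o : Instr)
  | seq (P Q : Prog)
  | loop (P : Prog)

/-- `P.Rel σ τ`: some execution of `P` from state `σ` ends in state `τ`. -/
def Prog.Rel : Prog → State → State → Prop
  | op o, σ, τ => o.Guard σ ∧ τ = o.update σ
  | seq P Q, σ, τ => ∃ ρ, P.Rel σ ρ ∧ Q.Rel ρ τ
  | loop P, σ, τ => Relation.ReflTransGen P.Rel σ τ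

/-! ### Predicates verified by loop programs -/

/-- The predicate `R` concerns only the registers below `s`, and some program can be executed to
the end exactly from the states that satisfy `R`, leaving the registers below `s` as they were. -/
structure Checkable (s : ℕ) (R : State → Prop) : Prop where
  congr_below : ∀ σ τ : State, (∀ i < s, σ i = τ i) → R σ → R τ
  exists_prog : ∃ P : Prog, (∀ σ τ, P.Rel σ τ → R σ ∧ ∀ i < s, τ i = σ i) ∧
    ∀ σ, R σ → ∃ τ, P.Rel σ τ

namespace Checkable

open Prog Instr

variable {s : ℕ} {R R' : State → Prop}

theorem of_iff (h : Checkable s R) (H : ∀ σ, R σ ↔ R' σ) : Checkable s R' := by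
  obtain rfl : R = R' := funext fun σ => propext (H σ)
  exact h

theorem eq {i j : ℕ} (hi : i < s) (hj : j < s) : Checkable s fun σ => σ i = σ j := by
  refine ⟨fun σ τ h e => by rw [← h i hi, ← h j hj, e], op (test i j), ?_, ?_⟩
  · rintro σ τ ⟨h, rfl⟩
    exact ⟨h, fun _ _ => rfl⟩
  · exact fun σ h => ⟨_, h, rfl⟩

theorem true : Checkable s fun _ => True := by
  refine ⟨fun _ _ _ _ => trivial, op (zero s), ?_, fun σ _ => ⟨_, trivial, rfl⟩⟩
  rintro σ τ ⟨-, rfl⟩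
  exact ⟨trivial, fun i hi => by simp [Instr.update, Function.update_of_ne hi.ne]⟩

theorem eq_zero {i : ℕ} (hi : i < s) : Checkable s fun σ => σ i = 0 := by
  refine ⟨fun σ τ h e => by rw [← h i hi, e], seq (op (zero s)) (op (test i s)), ?_, ?_⟩
  · rintro σ τ ⟨_, ⟨-, rfl⟩, h, rfl⟩
    refine ⟨?_, fun j hj => ?_⟩
    · simpa [Guard, Instr.update, Function.update_of_ne hi.ne] using h
    · simp [Instr.update, Function.update_of_ne hj.ne]
  · intro σ h
    exact ⟨_, _, ⟨trivial, rfl⟩, by simpa [Guard, Instr.update, Function.update_of_ne hi.ne], rfl⟩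

theorem eq_succ {i j : ℕ} (hi : i < s) (hj : j < s) : Checkable s fun σ => σ i = σ j + 1 := by
  refine ⟨fun σ τ h e => by rw [← h i hi, ← h j hj, e],
    seq (op (set s j)) (seq (op (inc s)) (op (test i s))), ?_, ?_⟩
  · rintro σ τ ⟨_, ⟨-, rfl⟩, _, ⟨-, rfl⟩, h, rfl⟩
    refine ⟨?_, fun j hj => ?_⟩
    · simpa [Guard, Instr.update, Function.update_of_ne hi.ne] using h
    · simp [Instr.update, Function.update_of_ne hj.ne]
  · intro σ h
    exact ⟨_, _, ⟨trivial, rfl⟩, _, ⟨trivial, rfl⟩,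
      by simpa [Guard, Instr.update, Function.update_of_ne hi.ne], rfl⟩

theorem and (h : Checkable s R) (h' : Checkable s R') : Checkable s fun σ => R σ ∧ R' σ := by
  obtain ⟨hc, P, hP, hP'⟩ := h
  obtain ⟨hc', Q, hQ, hQ'⟩ := h'
  refine ⟨fun σ τ H e => ⟨hc σ τ H e.1, hc' σ τ H e.2⟩, seq P Q, ?_, ?_⟩
  · rintro σ τ ⟨ρ, h₁, h₂⟩
    obtain ⟨a₁, b₁⟩ := hP _ _ h₁
    obtain ⟨a₂, b₂⟩ := hQ _ _ h₂
    exact ⟨⟨a₁, hc' ρ σ b₁ a₂⟩, fun i hi => (b₂ i hi).trans (b₁ i hi)⟩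
  · rintro σ ⟨a₁, a₂⟩
    obtain ⟨ρ, h₁⟩ := hP' σ a₁
    obtain ⟨τ, h₂⟩ := hQ' ρ (hc' σ ρ (fun i hi => ((hP _ _ h₁).2 i hi).symm) a₂)
    exact ⟨τ, ρ, h₁, h₂⟩

theorem forall_fin : ∀ {n : ℕ} {R : Fin n → State → Prop}, (∀ i, Checkable s (R i)) →
    Checkable s fun σ => ∀ i, R i σ
  | 0, _, _ => true.of_iff fun _ => by simp
  | _ + 1, R, h => ((h 0).and (forall_fin fun i => h i.succ)).of_iff fun σ =>
      (Fin.forall_fin_succ (P := fun i => R i σ)).symm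

/-- The program that writes an arbitrary number into register `i`. -/
def guess (i : ℕ) : Prog := seq (op (zero i)) (loop (op (inc i)))

theorem guess_rel {i : ℕ} {σ τ : State} :
    (guess i).Rel σ τ ↔ ∃ k, τ = Function.update σ i k := by
  constructor
  · rintro ⟨_, ⟨-, rfl⟩, h⟩
    change Relation.ReflTransGen _ _ _ at h
    induction h with
    | refl => exact ⟨0, rfl⟩
    | tail _ h ih =>
      obtain ⟨k, rfl⟩ := ih
      obtain ⟨-, rfl⟩ := h
      exact ⟨k + 1, by simp [Instr.update]⟩
  · rintro ⟨k, rfl⟩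
    refine ⟨_, ⟨trivial, rfl⟩, ?_⟩
    change Relation.ReflTransGen _ _ _
    induction k with
    | zero => exact .refl
    | succ k ih => exact ih.tail ⟨trivial, by simp [Instr.update]⟩

theorem exists_register (h : Checkable (s + 1) R) :
    Checkable s fun σ => ∃ τ : State, (∀ i < s, τ i = σ i) ∧ R τ := by
  obtain ⟨hc, P, hP, hP'⟩ := h
  refine ⟨fun σ τ H ⟨ρ, h₁, h₂⟩ => ⟨ρ, fun i hi => (h₁ i hi).trans (H i hi), h₂⟩,
    seq (guess s) P, ?_, ?_⟩
  · rintro σ τ ⟨ρ, h₁, h₂⟩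
    obtain ⟨k, rfl⟩ := guess_rel.1 h₁
    obtain ⟨a, b⟩ := hP _ _ h₂
    have hlt : ∀ i < s, Function.update σ s k i = σ i := fun i hi => Function.update_of_ne hi.ne _ _
    exact ⟨⟨_, hlt, a⟩, fun i hi => (b i (by omega)).trans (hlt i hi)⟩
  · rintro σ ⟨ρ, h₁, h₂⟩
    obtain ⟨τ, h⟩ := hP' (Function.update σ s (ρ s)) <| hc ρ _ (fun i hi => by
      rcases Nat.lt_succ_iff_lt_or_eq.1 hi with hi | rfl
      · rw [Function.update_of_ne hi.ne, h₁ i hi]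
      · simp) h₂
    exact ⟨τ, _, guess_rel.2 ⟨_, rfl⟩, h⟩

/-- Checkable predicates are closed under existential quantification over registers. -/
theorem exists_registers : ∀ (n : ℕ) {R : State → Prop}, Checkable (s + n) R →
    Checkable s fun σ => ∃ τ : State, (∀ i < s, τ i = σ i) ∧ R τ
  | 0, R, h => h.of_iff fun σ =>
      ⟨fun H => ⟨σ, fun _ _ => rfl, H⟩, fun ⟨τ, H, H'⟩ => h.congr_below τ σ H H'⟩
  | n + 1, R, h => (exists_registers n (exists_register (s := s + n) h)).of_iff fun σ => by
      constructor
      · rintro ⟨τ, h₁, ρ, h₂, h₃⟩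
        exact ⟨ρ, fun i hi => (h₂ i (by omega)).trans (h₁ i hi), h₃⟩
      · rintro ⟨τ, h₁, h₂⟩
        exact ⟨τ, h₁, τ, fun _ _ => rfl, h₂⟩

theorem ne_zero {i : ℕ} (hi : i < s) : Checkable s fun σ => σ i ≠ 0 :=
  (exists_registers 1 (eq_succ (s := s + 1) (i := i) (j := s) (by omega) (by omega))).of_iff
    fun σ => by
      constructor
      · rintro ⟨τ, h₁, h₂⟩
        rw [← h₁ i hi, h₂]
        exact Nat.succ_ne_zero _
      · intro h
        refine ⟨Function.update σ s (σ i - 1), fun j hj => Function.update_of_ne hj.ne _ _, ?_⟩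
        rw [Function.update_of_ne hi.ne, Function.update_self]
        omega

/-- The state that agrees with `σ` below `s`, and holds `i`, `x`, `y` in registers `s`, `s + 1`,
`s + 2`. -/
def extend (s : ℕ) (σ : State) (i x y : ℕ) : State :=
  fun k => if k < s then σ k else if k = s then i else if k = s + 1 then x else y

theorem extend_of_lt {σ : State} {i x y k : ℕ} (h : k < s) : extend s σ i x y k = σ k := by
  simp [extend, h]

@[simp] theorem extend_zero {σ : State} {i x y : ℕ} : extend s σ i x y s = i := by
  simp [extend]

@[simp] theorem extend_one {σ : State} {i x y : ℕ} : extend s σ i x y (s + 1) = x := by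
  simp [extend]

@[simp] theorem extend_two {σ : State} {i x y : ℕ} : extend s σ i x y (s + 2) = y := by
  simp [extend]

theorem eq_extend_of_lt_two {σ τ : State} {i x : ℕ} (y : ℕ) (h : ∀ k < s, τ k = σ k)
    (h0 : τ s = i) (h1 : τ (s + 1) = x) : ∀ k < s + 2, τ k = extend s σ i x y k := by
  intro k hk
  rcases lt_or_ge k s with hs | hs
  · rw [extend_of_lt hs, h k hs]
  obtain rfl | rfl : k = s ∨ k = s + 1 := by omega
  · simp [h0]
  · simp [h1]

theorem eq_extend_of_lt_three {σ τ : State} {i x y : ℕ} (h : ∀ k < s, τ k = σ k)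
    (h0 : τ s = i) (h1 : τ (s + 1) = x) (h2 : τ (s + 2) = y) :
    ∀ k < s + 3, τ k = extend s σ i x y k := by
  intro k hk
  rcases lt_or_ge k (s + 2) with hs | hs
  · exact eq_extend_of_lt_two y h h0 h1 k hs
  obtain rfl : k = s + 2 := by omega
  simp [h2]

/-- Checkable predicates are closed under iteration: one can check that there is a sequence
`a 0, …, a n` whose first term satisfies `I`, whose last term satisfies `F` and whose consecutive
terms satisfy `B`. Register `s` holds the current index and register `s + 1` the current term,
while `s + 2` is used for guessing the next term. -/
theorem iterate {I B F : State → Prop} (hI : Checkable (s + 2) I) (hB : Checkable (s + 3) B)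
    (hF : Checkable (s + 2) F) :
    Checkable s fun σ => ∃ (a : ℕ → ℕ) (n : ℕ), I (extend s σ 0 (a 0) 0) ∧
      (∀ i < n, B (extend s σ i (a i) (a (i + 1)))) ∧ F (extend s σ n (a n) 0) := by
  obtain ⟨cI, PI, sI, tI⟩ := hI
  obtain ⟨cB, PB, sB, tB⟩ := hB
  obtain ⟨cF, PF, sF, tF⟩ := hF
  set body : Prog := seq (guess (s + 2)) (seq PB (seq (op (set (s + 1) (s + 2))) (op (inc s))))
    with hbody
  have ext_congr : ∀ (σ τ : State), (∀ k < s, σ k = τ k) → ∀ i x y,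
      extend s σ i x y = extend s τ i x y := by
    intro σ τ h i x y
    funext k
    by_cases hk : k < s
    · rw [extend_of_lt hk, extend_of_lt hk, h k hk]
    · simp [extend, hk]
  refine ⟨fun σ τ h => ?_, seq (op (zero s)) (seq (guess (s + 1)) (seq PI (seq (loop body) PF))),
    ?_, ?_⟩
  · simp only [ext_congr σ τ h]
    exact id
  · rintro σ τ ⟨_, ⟨-, rfl⟩, ρ₁, h₁, ρ₂, h₂, ρ₃, h₃, h₄⟩
    obtain ⟨x₀, rfl⟩ := guess_rel.1 h₁
    obtain ⟨hI, e₂⟩ := sI _ _ h₂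
    have hinv : ∃ (a : ℕ → ℕ) (n : ℕ), I (extend s σ 0 (a 0) 0) ∧
        (∀ i < n, B (extend s σ i (a i) (a (i + 1)))) ∧ (∀ k < s, ρ₃ k = σ k) ∧ ρ₃ s = n ∧
        ρ₃ (s + 1) = a n := by
      clear h₄
      change Relation.ReflTransGen _ _ _ at h₃
      induction h₃ with
      | refl =>
        have E : ∀ k < s, Function.update (Instr.update (zero s) σ) (s + 1) x₀ k = σ k := by
          intro k hk
          rw [Function.update_of_ne (by omega)]
          exact Function.update_of_ne (by omega) _ _
        refine ⟨fun _ => x₀, 0, cI _ _ (eq_extend_of_lt_two 0 E ?_ ?_) hI, by simp,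
          fun k hk => (e₂ k (by omega)).trans (E k hk), ?_, ?_⟩
        · simp [Instr.update]
        · simp
        · rw [e₂ s (by omega)]
          simp [Instr.update]
        · rw [e₂ (s + 1) (by omega)]
          simp
      | @tail ρ ρ' _ h ih =>
        obtain ⟨a, n, H₁, H₂, H₃, H₄, H₅⟩ := ih
        obtain ⟨_, g, μ, hμ, _, ⟨-, rfl⟩, -, rfl⟩ := h
        obtain ⟨y, rfl⟩ := guess_rel.1 g
        obtain ⟨hBy, eμ⟩ := sB _ _ hμ
        have f₀ : ∀ k < s, μ k = σ k := fun k hk => by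
          rw [eμ k (by omega), Function.update_of_ne (by omega), H₃ k hk]
        have f₁ : μ s = n := by
          rw [eμ s (by omega), Function.update_of_ne (by omega), H₄]
        have f₃ : μ (s + 2) = y := by
          rw [eμ (s + 2) (by omega), Function.update_self]
        refine ⟨Function.update a (n + 1) y, n + 1, ?_, ?_, ?_, ?_, ?_⟩
        · rwa [Function.update_of_ne (by omega)]
        · intro i hi
          rcases Nat.lt_succ_iff_lt_or_eq.1 hi with hi | rfl
          · rw [Function.update_of_ne (by omega), Function.update_of_ne (by omega)]
            exact H₂ i hi
          · rw [Function.update_of_ne (by omega), Function.update_self]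
            refine cB _ _ (eq_extend_of_lt_three (fun k hk => ?_) ?_ ?_ ?_) hBy
            · rw [Function.update_of_ne (by omega), H₃ k hk]
            · rw [Function.update_of_ne (by omega), H₄]
            · rw [Function.update_of_ne (by omega), H₅]
            · simp
        · intro k hk
          simp only [Instr.update]
          rw [Function.update_of_ne (by omega), Function.update_of_ne (by omega), f₀ k hk]
        · simp [Instr.update, f₁]
        · simp [Instr.update, f₃]
    obtain ⟨a, n, H₁, H₂, H₃, H₄, H₅⟩ := hinv
    obtain ⟨hF, e₄⟩ := sF _ _ h₄
    exact ⟨⟨a, n, H₁, H₂, cF _ _ (eq_extend_of_lt_two 0 H₃ H₄ H₅) hF⟩,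
      fun k hk => (e₄ k (by omega)).trans (H₃ k hk)⟩
  · rintro σ ⟨a, n, H₁, H₂, H₃⟩
    have E : ∀ k < s, Function.update (Instr.update (zero s) σ) (s + 1) (a 0) k = σ k := by
      intro k hk
      rw [Function.update_of_ne (by omega)]
      exact Function.update_of_ne (by omega) _ _
    have E0 : Function.update (Instr.update (zero s) σ) (s + 1) (a 0) s = 0 := by
      simp [Instr.update]
    have E1 : Function.update (Instr.update (zero s) σ) (s + 1) (a 0) (s + 1) = a 0 := by simp
    obtain ⟨ρ, hρ⟩ := tI _ (cI _ _ (fun k hk => (eq_extend_of_lt_two 0 E E0 E1 k hk).symm) H₁)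
    have eρ := (sI _ _ hρ).2
    have hloop : ∀ m ≤ n, ∃ μ, Relation.ReflTransGen body.Rel ρ μ ∧ (∀ k < s, μ k = σ k) ∧
        μ s = m ∧ μ (s + 1) = a m := by
      intro m
      induction m with
      | zero =>
        intro _
        exact ⟨ρ, .refl, fun k hk => (eρ k (by omega)).trans (E k hk),
          (eρ s (by omega)).trans E0, (eρ (s + 1) (by omega)).trans E1⟩
      | succ m ih =>
        intro hm
        obtain ⟨μ, hμ, K₀, K₁, K₂⟩ := ih (by omega)
        obtain ⟨ν, hν⟩ := tB (Function.update μ (s + 2) (a (m + 1))) <|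
          cB _ _ (fun k hk => (eq_extend_of_lt_three (fun k hk => by
              rw [Function.update_of_ne (by omega), K₀ k hk])
            (by rw [Function.update_of_ne (by omega), K₁])
            (by rw [Function.update_of_ne (by omega), K₂]) (by simp) k hk).symm) (H₂ m hm)
        have eν := (sB _ _ hν).2
        refine ⟨_, hμ.tail ⟨_, guess_rel.2 ⟨_, rfl⟩, ν, hν, _, ⟨trivial, rfl⟩, trivial, rfl⟩,
          fun k hk => ?_, ?_, ?_⟩
        · simp only [Instr.update]
          rw [Function.update_of_ne (by omega), Function.update_of_ne (by omega),
            eν k (by omega), Function.update_of_ne (by omega), K₀ k hk]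
        · simp only [Instr.update]
          rw [Function.update_self, Function.update_of_ne (by omega), eν s (by omega),
            Function.update_of_ne (by omega), K₁]
        · simp only [Instr.update]
          rw [Function.update_of_ne (by omega), Function.update_self, eν (s + 2) (by omega),
            Function.update_self]
    obtain ⟨μ, hμ, K₀, K₁, K₂⟩ := hloop n le_rfl
    obtain ⟨τ, hτ⟩ := tF μ (cF _ _ (fun k hk => (eq_extend_of_lt_two 0 K₀ K₁ K₂ k hk).symm) H₃)
    exact ⟨τ, _, ⟨trivial, rfl⟩, _, guess_rel.2 ⟨_, rfl⟩, ρ, hρ, μ, hμ, hτ⟩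

end Checkable

end LoopProgram

/-! ### Partial recursive functions -/

namespace LoopProgram

open List.Vector

theorem mem_mOfFn {α : Type} : ∀ {n : ℕ} {g : Fin n → Part α} {w : List.Vector α n},
    w ∈ (List.Vector.mOfFn g : Part (List.Vector α n)) ↔ ∀ i, w.get i ∈ g i
  | 0, g, w => by
    simp [List.Vector.mOfFn, Part.pure_eq_some, eq_iff_true_of_subsingleton]
  | n + 1, g, w => by
    simp only [List.Vector.mOfFn, Part.bind_eq_bind, Part.pure_eq_some, Part.mem_bind_iff,
      Part.mem_some_iff, mem_mOfFn]
    constructor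
    · rintro ⟨a, ha, v, hv, rfl⟩
      exact fun i => Fin.cases (by simpa using ha) (fun i => by simpa using hv i) i
    · intro h
      exact ⟨w.head, by simpa using h 0, w.tail, fun i => by simpa using h i.succ, by simp⟩

/-- The values of the registers `x 0, …, x (n - 1)`. -/
def read {n : ℕ} (x : Fin n → ℕ) (σ : State) : List.Vector ℕ n := ofFn fun i => σ (x i)

@[simp] theorem get_read {n : ℕ} (x : Fin n → ℕ) (σ : State) (i : Fin n) :
    (read x σ).get i = σ (x i) := by simp [read]

theorem read_succ {n : ℕ} (x : Fin (n + 1) → ℕ) (σ : State) :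
    read x σ = σ (x 0) ::ᵥ read (fun i => x i.succ) σ := rfl

@[simp] theorem read_cons {n : ℕ} (a : ℕ) (x : Fin n → ℕ) (σ : State) :
    read (Fin.cons a x : Fin (n + 1) → ℕ) σ = σ a ::ᵥ read x σ := rfl

theorem read_congr {n : ℕ} {x : Fin n → ℕ} {σ τ : State} (h : ∀ i, σ (x i) = τ (x i)) :
    read x σ = read x τ := by simp [read, h]

/-- Some program can check that `y` is the value of `f` at `x 0, …, x (n - 1)`, whatever the
registers `x i` and `y` are. -/
def Representable {n : ℕ} (f : List.Vector ℕ n →. ℕ) : Prop :=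
  ∀ (s : ℕ) (x : Fin n → ℕ) (y : ℕ), (∀ i, x i < s) → y < s →
    Checkable s fun σ => σ y ∈ f (read x σ)

namespace Representable

theorem comp {m n : ℕ} {f : List.Vector ℕ n →. ℕ} (g : Fin n → List.Vector ℕ m →. ℕ)
    (hf : Representable f) (hg : ∀ i, Representable (g i)) :
    Representable fun v => (List.Vector.mOfFn fun i => g i v) >>= f := by
  intro s x y hx hy
  refine (Checkable.exists_registers n ((Checkable.forall_fin fun i =>
    hg i (s + n) x (s + i) (fun j => (hx j).trans_le (by omega)) (by omega)).and
    (hf (s + n) (fun i => s + i) y (fun i => by omega) (by omega)))).of_iff fun σ => ?_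
  refine Iff.trans ?_ (Part.mem_bind_iff (f := List.Vector.mOfFn fun i => g i (read x σ))).symm
  simp only [mem_mOfFn]
  constructor
  · rintro ⟨τ, h₁, h₂, h₃⟩
    refine ⟨read (fun i : Fin n => s + i) τ, fun i => ?_, ?_⟩
    · rw [get_read, ← read_congr fun j => h₁ _ (hx j)]
      exact h₂ i
    · rwa [← h₁ y hy]
  · rintro ⟨w, h₁, h₂⟩
    have hw : read (fun i : Fin n => s + i)
        (fun k => if h : s ≤ k ∧ k < s + n then w.get ⟨k - s, by omega⟩ else σ k) = w := by
      ext i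
      simp
    refine ⟨fun k => if h : s ≤ k ∧ k < s + n then w.get ⟨k - s, by omega⟩ else σ k,
      fun i hi => by simp [hi.not_ge], fun i => ?_, ?_⟩
    · rw [read_congr (τ := σ) fun j => by simp [(hx j).not_ge]]
      simpa using h₁ i
    · rw [hw]
      simpa [hy.not_ge] using h₂

theorem prec {n : ℕ} {f : List.Vector ℕ n → ℕ} {g : List.Vector ℕ (n + 2) → ℕ}
    (hf : Representable (n := n) f) (hg : Representable (n := n + 2) g) :
    Representable (n := n + 1) (fun v : List.Vector ℕ (n + 1) =>
      Part.some (v.head.rec (f v.tail) fun i r => g (i ::ᵥ r ::ᵥ v.tail))) := by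
  intro s x y hx hy
  -- The sequence that is guessed consists of the values of the recursion.
  have hI := hf (s + 2) (fun i => x i.succ) (s + 1) (fun i => (hx _).trans (by omega)) (by omega)
  have hB := hg (s + 3) (Fin.cons s (Fin.cons (s + 1) fun i => x i.succ)) (s + 2)
    (fun i => by
      refine Fin.cases ?_ (fun i => Fin.cases ?_ (fun i => ?_) i) i
      · simp
      · simp
      · simpa using (hx i.succ).trans (by omega)) (by omega)
  have hF := (Checkable.eq (s := s + 2) (i := s) (j := x 0) (by omega)
    ((hx _).trans (by omega))).and
      (Checkable.eq (s := s + 2) (i := s + 1) (j := y) (by omega) (by omega))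
  refine (Checkable.iterate hI hB hF).of_iff fun σ => ?_
  have hr : ∀ i x' y', read (fun i => x i.succ) (Checkable.extend s σ i x' y') =
      read (fun i => x i.succ) σ := fun i x' y' =>
    read_congr fun j => Checkable.extend_of_lt (hx _)
  simp only [PFun.coe_val, Part.mem_some_iff, read_cons, hr, Checkable.extend_zero,
    Checkable.extend_one, Checkable.extend_two, Checkable.extend_of_lt (hx 0),
    Checkable.extend_of_lt hy, read_succ x, head_cons, tail_cons]
  constructor
  · rintro ⟨a, n, h₁, h₂, rfl, h₃⟩
    rw [← h₃]
    clear h₃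
    generalize σ (x 0) = n at h₂
    induction n with
    | zero => exact h₁
    | succ n ih => rw [h₂ n n.lt_succ_self, ih fun i hi => h₂ i (by omega)]
  · intro h
    exact ⟨fun i => i.rec (f (read (fun i => x i.succ) σ))
      fun i r => g (i ::ᵥ r ::ᵥ read (fun i => x i.succ) σ), σ (x 0), rfl, fun _ _ => rfl, rfl,
      h.symm⟩

theorem rfind {n : ℕ} {f : List.Vector ℕ (n + 1) → ℕ} (hf : Representable (n := n + 1) f) :
    Representable fun v => Nat.rfind fun n => Part.some (f (n ::ᵥ v) = 0) := by
  intro s x y hx hy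
  have hx' : ∀ i, (Fin.cons s x : Fin (n + 1) → ℕ) i < s + 2 := fun i =>
    Fin.cases (by simp) (fun i => by simpa using (hx i).trans (by omega)) i
  have hB := (hf (s + 3) (Fin.cons s x) (s + 1) (fun i => (hx' i).trans (by omega))
    (by omega)).and (Checkable.ne_zero (s := s + 3) (i := s + 1) (by omega))
  have hF := (hf (s + 2) (Fin.cons s x) (s + 1) hx' (by omega)).and
    ((Checkable.eq_zero (s := s + 2) (i := s + 1) (by omega)).and
      (Checkable.eq (s := s + 2) (i := s) (j := y) (by omega) (by omega)))
  refine (Checkable.iterate Checkable.true hB hF).of_iff fun σ => ?_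
  have hr : ∀ i x' y', read x (Checkable.extend s σ i x' y') = read x σ := fun i x' y' =>
    read_congr fun j => Checkable.extend_of_lt (hx _)
  refine Iff.trans ?_
    (Nat.mem_rfind (p := fun n => Part.some (decide (f (n ::ᵥ read x σ) = 0)))).symm
  simp only [PFun.coe_val, Part.mem_some_iff, read_cons, hr, Checkable.extend_zero,
    Checkable.extend_one, Checkable.extend_of_lt hy, true_and]
  constructor
  · rintro ⟨a, n, h₁, h₂, h₃, rfl⟩
    refine ⟨by simp [← h₂, h₃], fun {m} hm => ?_⟩
    have := h₁ m hm
    simpa [← this.1] using this.2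
  · rintro ⟨h₁, h₂⟩
    -- The sequence that is guessed consists of the values of `f` met by the search.
    refine ⟨fun i => f (i ::ᵥ read x σ), σ y, fun i hi => ⟨rfl, ?_⟩, rfl, ?_, rfl⟩
    · simpa using h₂ hi
    · simpa using h₁

theorem of_primrec' {n : ℕ} {f : List.Vector ℕ n → ℕ} (hf : Nat.Primrec' f) :
    Representable (n := n) f := by
  induction hf with
  | zero =>
    intro s x y _ hy
    exact (Checkable.eq_zero hy).of_iff fun σ => by simp
  | succ =>
    intro s x y hx hy
    exact (Checkable.eq_succ hy (hx 0)).of_iff fun σ => by simp [read_succ]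
  | get i =>
    intro s x y hx hy
    exact (Checkable.eq hy (hx i)).of_iff fun σ => by simp
  | comp g _ _ ihf ihg =>
    have h := comp (fun i v => Part.some (g i v)) ihf ihg
    intro s x y hx hy
    refine (h s x y hx hy).of_iff fun σ => ?_
    simp only [Vector.mOfFn_part_some]
    exact (iff_of_eq (congrArg (σ y ∈ ·) (Part.bind_some _ _))).trans .rfl
  | prec _ _ ihf ihg => exact prec ihf ihg

theorem of_partrec' {n : ℕ} {f : List.Vector ℕ n →. ℕ} (hf : Nat.Partrec' f) :
    Representable f := by
  induction hf with
  | prim h => exact of_primrec' h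
  | comp g _ _ ihf ihg => exact comp g ihf ihg
  | rfind _ ih => exact rfind ih

end Representable

/-- The domain of a partial recursive function is the set of inputs on which some loop program
can be executed to the end. -/
theorem exists_prog_of_partrec {f : ℕ →. ℕ} (hf : Partrec f) :
    ∃ P : Prog, ∀ n, (f n).Dom ↔ ∃ τ, P.Rel (fun i => if i = 0 then n else 0) τ := by
  have h := Representable.of_partrec' (Nat.Partrec'.part_iff₁.2 hf) 2 (fun _ => 0) 1 (by simp)
    (by simp)
  obtain ⟨-, P, h₁, h₂⟩ := Checkable.exists_register h
  refine ⟨P, fun n => ⟨fun hn => h₂ _ ?_, fun ⟨τ, hτ⟩ => ?_⟩⟩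
  · obtain ⟨r, hr⟩ := Part.dom_iff_mem.1 hn
    exact ⟨fun i => if i = 0 then n else r, by simp, by simpa [read_succ] using hr⟩
  · obtain ⟨ρ, e, hρ⟩ := (h₁ _ _ hτ).1
    have e0 : ρ 0 = n := by simpa using e 0 (by simp)
    rw [read_succ, head_cons, e0] at hρ
    exact Part.dom_iff_mem.2 ⟨_, hρ⟩

end LoopProgram

/-! ### Control flow of loop programs -/

namespace LoopProgram

open Prog

/-- The control states reachable by one transition from the control state `c`, the list of the
programs that remain to be executed, with the instruction that is executed on the way. The
instruction `test 0 0` does nothing. -/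
def edges : List Prog → List (Instr × List Prog)
  | [] => []
  | op o :: c => [(o, c)]
  | seq P Q :: c => [(.test 0 0, P :: Q :: c)]
  | loop P :: c => [(.test 0 0, c), (.test 0 0, P :: loop P :: c)]

/-- The control states that occur while `P` is executed with `c` still to follow. -/
def controls : Prog → List Prog → List (List Prog)
  | op o, c => [op o :: c]
  | seq P Q, c => (seq P Q :: c) :: (controls P (Q :: c) ++ controls Q c)
  | loop P, c => (loop P :: c) :: controls P (loop P :: c)

theorem cons_mem_controls (P : Prog) (c : List Prog) : P :: c ∈ controls P c := by
  cases P <;> simp [controls]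

/-- Execution of `P` leaves the finite list `controls P c` only for the continuation `c`. Hence a
program has finitely many control states. -/
theorem mem_controls_of_edge {P : Prog} {c d : List Prog} {e : Instr × List Prog}
    (hd : d ∈ controls P c) (he : e ∈ edges d) : e.2 ∈ controls P c ∨ e.2 = c := by
  induction P generalizing c with
  | op o =>
    simp only [controls, List.mem_singleton] at hd
    subst hd
    simp only [edges, List.mem_singleton] at he
    simp [he]
  | seq P Q ihP ihQ =>
    simp only [controls, List.mem_cons, List.mem_append] at hd ⊢
    rcases hd with rfl | hd | hd
    · simp only [edges, List.mem_singleton] at he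
      simp [he, cons_mem_controls]
    · rcases ihP hd with h | h
      · simp [h]
      · simp [h, cons_mem_controls]
    · rcases ihQ hd with h | h <;> simp [h]
  | loop P ih =>
    simp only [controls, List.mem_cons] at hd ⊢
    rcases hd with rfl | hd
    · simp only [edges, List.mem_cons, List.not_mem_nil, or_false] at he
      rcases he with rfl | rfl <;> simp [cons_mem_controls]
    · rcases ih hd with h | h <;> simp [h]

/-- One transition between configurations, a configuration being a control state together with a
memory state. -/
def Step (a b : List Prog × State) : Prop :=
  ∃ e ∈ edges a.1, e.1.Guard a.2 ∧ b = (e.2, e.1.update a.2)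

/-- The effect of executing a list of programs one after the other. -/
def SeqRel : List Prog → State → State → Prop
  | [], σ, τ => σ = τ
  | P :: c, σ, τ => ∃ ρ, P.Rel σ ρ ∧ SeqRel c ρ τ

theorem SeqRel.of_step {a b : List Prog × State} {τ : State} (h : Step a b)
    (hb : SeqRel b.1 b.2 τ) : SeqRel a.1 a.2 τ := by
  obtain ⟨c, σ⟩ := a
  obtain ⟨e, he, hg, rfl⟩ := h
  match c, he with
  | op o :: c, he =>
    simp only [edges, List.mem_singleton] at he
    subst he
    exact ⟨_, ⟨hg, rfl⟩, hb⟩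
  | seq P Q :: c, he =>
    simp only [edges, List.mem_singleton] at he
    subst he
    obtain ⟨ρ, h₁, μ, h₂, h₃⟩ := hb
    exact ⟨μ, ⟨ρ, h₁, h₂⟩, h₃⟩
  | loop P :: c, he =>
    simp only [edges, List.mem_cons, List.not_mem_nil, or_false] at he
    rcases he with rfl | rfl
    · exact ⟨σ, .refl, hb⟩
    · obtain ⟨ρ, h₁, μ, h₂, h₃⟩ := hb
      exact ⟨μ, .head h₁ h₂, h₃⟩

theorem Prog.Rel.steps {P : Prog} {σ τ : State} (h : P.Rel σ τ) (c : List Prog) :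
    Relation.ReflTransGen Step (P :: c, σ) (c, τ) := by
  induction P generalizing σ τ c with
  | op o =>
    obtain ⟨hg, rfl⟩ := h
    exact .single ⟨(o, c), by simp [edges], hg, rfl⟩
  | seq P Q ihP ihQ =>
    obtain ⟨ρ, h₁, h₂⟩ := h
    exact .head ⟨(.test 0 0, P :: Q :: c), by simp [edges], rfl, rfl⟩
      ((ihP h₁ _).trans (ihQ h₂ _))
  | loop P ih =>
    change Relation.ReflTransGen _ _ _ at h
    induction h using Relation.ReflTransGen.head_induction_on with
    | refl => exact .single ⟨(.test 0 0, c), by simp [edges], rfl, rfl⟩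
    | head h₁ _ ih' =>
      exact .head ⟨(.test 0 0, P :: loop P :: c), by simp [edges], rfl, rfl⟩
        ((ih h₁ _).trans ih')

/-- The small-step semantics agrees with the relational one. -/
theorem rel_iff_steps {P : Prog} {σ τ : State} :
    P.Rel σ τ ↔ Relation.ReflTransGen Step ([P], σ) ([], τ) := by
  refine ⟨fun h => h.steps [], fun h => ?_⟩
  have : SeqRel [P] σ τ := by
    generalize hb : (([], τ) : List Prog × State) = b at h
    have : ∀ a, Relation.ReflTransGen Step a b → SeqRel a.1 a.2 τ := by
      intro a ha
      induction ha using Relation.ReflTransGen.head_induction_on with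
      | refl => subst hb; rfl
      | head h _ ih => exact .of_step h ih
    exact this _ h
  obtain ⟨ρ, hρ, rfl⟩ := this
  exact hρ

end LoopProgram

/-! ### Linear rules with equality tests -/

open Matrix

/-- A rule on vectors `x : κ → ℕ`: a linear map, and a list of pairs of linear forms that have to
agree at `x`. -/
structure LinearRule (κ : Type) where
  /-- The coefficients of the linear form that gives the new coordinate `k`. -/
  form (k : κ) : κ → ℕ
  /-- The pairs of linear forms that have to agree. -/
  tests : List ((κ → ℕ) × (κ → ℕ))

namespace LinearRule

variable {κ : Type} [Fintype κ]

/-- The new vector. -/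
def apply (r : LinearRule κ) (x : κ → ℕ) : κ → ℕ := fun k => r.form k ⬝ᵥ x

/-- The tests of the rule are met. -/
def Valid (r : LinearRule κ) (x : κ → ℕ) : Prop := ∀ t ∈ r.tests, t.1 ⬝ᵥ x = t.2 ⬝ᵥ x

/-- Apply a list of rules, starting with its head. -/
def run : List (LinearRule κ) → (κ → ℕ) → κ → ℕ
  | [], x => x
  | r :: w, x => run w (r.apply x)

/-- All the tests met on the way are passed. -/
def ValidRun : List (LinearRule κ) → (κ → ℕ) → Prop
  | [], _ => True
  | r :: w, x => r.Valid x ∧ ValidRun w (r.apply x)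

theorem run_append (w w' : List (LinearRule κ)) (x : κ → ℕ) :
    run (w ++ w') x = run w' (run w x) := by
  induction w generalizing x with
  | nil => rfl
  | cons r w ih => exact ih _

theorem validRun_append (w w' : List (LinearRule κ)) (x : κ → ℕ) :
    ValidRun (w ++ w') x ↔ ValidRun w x ∧ ValidRun w' (run w x) := by
  induction w generalizing x with
  | nil => simp [ValidRun, run]
  | cons r w ih => simp [ValidRun, run, ih, and_assoc]

/-- The sum of `a ^ 2 + b ^ 2` over the pairs `(a, b)` of numbers that are compared. -/
def squares (r : LinearRule κ) (x : κ → ℕ) : ℕ :=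
  (r.tests.map fun t => (t.1 ⬝ᵥ x) * (t.1 ⬝ᵥ x) + (t.2 ⬝ᵥ x) * (t.2 ⬝ᵥ x)).sum

/-- The sum of `2 * a * b` over the pairs `(a, b)` of numbers that are compared. -/
def cross (r : LinearRule κ) (x : κ → ℕ) : ℕ :=
  (r.tests.map fun t => 2 * ((t.1 ⬝ᵥ x) * (t.2 ⬝ᵥ x))).sum

theorem sum_cross_eq_sum_squares_iff {α : Type*} (l : List α) (f g : α → ℕ) :
    (l.map fun t => 2 * (f t * g t)).sum ≤ (l.map fun t => f t * f t + g t * g t).sum ∧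
    ((l.map fun t => 2 * (f t * g t)).sum = (l.map fun t => f t * f t + g t * g t).sum ↔
      ∀ t ∈ l, f t = g t) := by
  induction l with
  | nil => simp
  | cons t l ih =>
    have h : 2 * (f t * g t) ≤ f t * f t + g t * g t := by
      have := two_mul_le_add_sq (f t) (g t)
      nlinarith
    have h' : 2 * (f t * g t) = f t * f t + g t * g t ↔ f t = g t := by
      refine ⟨fun e => ?_, fun e => by rw [e]; ring⟩
      zify at e ⊢
      have : ((f t : ℤ) - g t) ^ 2 = 0 := by linear_combination -e
      exact sub_eq_zero.1 (pow_eq_zero_iff two_ne_zero |>.1 this)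
    simp only [List.map_cons, List.sum_cons, List.forall_mem_cons, ← ih.2, ← h']
    have := ih.1
    omega

theorem cross_le_squares (r : LinearRule κ) (x : κ → ℕ) : r.cross x ≤ r.squares x :=
  (sum_cross_eq_sum_squares_iff r.tests _ _).1

theorem cross_eq_squares_iff (r : LinearRule κ) (x : κ → ℕ) :
    r.cross x = r.squares x ↔ r.Valid x :=
  (sum_cross_eq_sum_squares_iff r.tests _ _).2

/-- The sum of `squares` along a run. -/
def runSquares : List (LinearRule κ) → (κ → ℕ) → ℕ
  | [], _ => 0
  | r :: w, x => r.squares x + runSquares w (r.apply x)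

/-- The sum of `cross` along a run. -/
def runCross : List (LinearRule κ) → (κ → ℕ) → ℕ
  | [], _ => 0
  | r :: w, x => r.cross x + runCross w (r.apply x)

theorem runCross_le_runSquares (w : List (LinearRule κ)) (x : κ → ℕ) :
    runCross w x ≤ runSquares w x := by
  induction w generalizing x with
  | nil => exact le_rfl
  | cons r w ih => exact add_le_add (r.cross_le_squares x) (ih _)

theorem runCross_eq_runSquares_iff (w : List (LinearRule κ)) (x : κ → ℕ) :
    runCross w x = runSquares w x ↔ ValidRun w x := by
  induction w generalizing x with
  | nil => simp [runCross, runSquares, ValidRun]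
  | cons r w ih =>
    have h₁ := r.cross_le_squares x
    have h₂ := runCross_le_runSquares w (r.apply x)
    rw [ValidRun, ← ih, ← r.cross_eq_squares_iff, runCross, runSquares]
    omega

/-! ### Runs of linear rules as matrix products -/

/-- The row vector made of the products of two coordinates of `x`, and of two accumulators. -/
def vec (x : κ → ℕ) (p m : ℕ) : (κ × κ) ⊕ Bool → ℕ :=
  Sum.elim (fun i => x i.1 * x i.2) fun b => if b then p else m

theorem sum_mul_mul_eq (x a b : κ → ℕ) :
    ∑ i : κ × κ, x i.1 * x i.2 * (a i.1 * b i.2) = (a ⬝ᵥ x) * (b ⬝ᵥ x) := by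
  rw [dotProduct, dotProduct, Finset.sum_mul_sum, Fintype.sum_prod_type]
  exact Finset.sum_congr rfl fun _ _ => Finset.sum_congr rfl fun _ _ => by ring

/-- The matrix by which a rule acts on `vec x p m`: it applies the linear map to `x`, and adds to
the accumulators the quadratic forms `squares` and `cross`. -/
def toMatrix (r : LinearRule κ) : Matrix ((κ × κ) ⊕ Bool) ((κ × κ) ⊕ Bool) ℕ :=
  Matrix.fromBlocks (.of fun i k => r.form k.1 i.1 * r.form k.2 i.2)
    (.of fun i b => if b then
        (r.tests.map fun t => t.1 i.1 * t.1 i.2 + t.2 i.1 * t.2 i.2).sum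
      else (r.tests.map fun t => 2 * (t.1 i.1 * t.2 i.2)).sum) 0 1

theorem vec_vecMul_toMatrix (r : LinearRule κ) (x : κ → ℕ) (p m : ℕ) :
    vec x p m ᵥ* r.toMatrix = vec (r.apply x) (p + r.squares x) (m + r.cross x) := by
  rw [toMatrix, vec, Matrix.vecMul_fromBlocks, vec]
  congr 1
  · funext k
    simp [vecMul, dotProduct, sum_mul_mul_eq, apply]
  · funext b
    cases b
    · suffices h : ∑ i : κ × κ, x i.1 * x i.2 *
          (r.tests.map fun t => 2 * (t.1 i.1 * t.2 i.2)).sum = r.cross x by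
        simpa [vecMul, dotProduct, add_comm] using h
      rw [cross]
      induction r.tests with
      | nil => simp
      | cons t l ih =>
        simp only [List.map_cons, List.sum_cons, mul_add, Finset.sum_add_distrib, ih,
          ← sum_mul_mul_eq, Finset.mul_sum]
        congr 1
        exact Finset.sum_congr rfl fun _ _ => by ring
    · suffices h : ∑ i : κ × κ, x i.1 * x i.2 *
          (r.tests.map fun t => t.1 i.1 * t.1 i.2 + t.2 i.1 * t.2 i.2).sum = r.squares x by
        simpa [vecMul, dotProduct, add_comm] using h
      rw [squares]
      induction r.tests with
      | nil => simp
      | cons t l ih =>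
        simp only [List.map_cons, List.sum_cons, mul_add, Finset.sum_add_distrib, ih,
          ← sum_mul_mul_eq]

theorem vec_vecMul_prod [DecidableEq κ] (w : List (LinearRule κ)) (x : κ → ℕ) (p m : ℕ) :
    vec x p m ᵥ* (w.map toMatrix).prod =
      vec (run w x) (p + runSquares w x) (m + runCross w x) := by
  induction w generalizing x p m with
  | nil => simp [run, runSquares, runCross]
  | cons r w ih =>
    simp [← vecMul_vecMul, vec_vecMul_toMatrix, ih, run, runSquares, runCross, add_assoc]

end LinearRule

/-! ### Loop programs as linear rules -/

namespace LoopProgram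

/-- All registers that the instruction mentions are below `D`. -/
def Instr.Below (D : ℕ) : Instr → Prop
  | test i j => i < D ∧ j < D
  | set i j => i < D ∧ j < D
  | zero i => i < D
  | inc i => i < D

theorem Instr.exists_below (o : Instr) : ∃ D, ∀ D' ≥ D, o.Below D' := by
  cases o with
  | test i j => exact ⟨i + j + 1, fun D' h => ⟨by omega, by omega⟩⟩
  | set i j => exact ⟨i + j + 1, fun D' h => ⟨by omega, by omega⟩⟩
  | zero i => exact ⟨i + 1, fun D' h => h⟩
  | inc i => exact ⟨i + 1, fun D' h => h⟩

theorem exists_below_of_list (l : List Instr) : ∃ D, ∀ o ∈ l, o.Below D := by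
  suffices ∃ D, ∀ D' ≥ D, ∀ o ∈ l, o.Below D' by
    obtain ⟨D, h⟩ := this
    exact ⟨D, h D le_rfl⟩
  induction l with
  | nil => simp
  | cons o l ih =>
    obtain ⟨D₁, h₁⟩ := ih
    obtain ⟨D₂, h₂⟩ := o.exists_below
    refine ⟨D₁ + D₂, fun D' h => ?_⟩
    simp only [List.forall_mem_cons]
    exact ⟨h₂ D' (by omega), h₁ D' (by omega)⟩

/-- The coordinates of a configuration: the registers below `D`, the constant `1` (index `true`)
and the number of the control state (index `false`). -/
abbrev Coord (D : ℕ) := Fin D ⊕ Bool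

/-- The coordinates of the configuration with memory state `σ` and control state number `p`. -/
def coords (D : ℕ) (σ : State) (p : ℕ) : Coord D → ℕ :=
  Sum.elim (fun i => σ i) fun b => if b then 1 else p

/-- The linear form that reads register `i`. -/
def reg (D i : ℕ) : Coord D → ℕ := Sum.elim (fun k => if k.val = i then 1 else 0) 0

/-- The linear form with constant value `p` on configurations. -/
def const (D p : ℕ) : Coord D → ℕ := Pi.single (.inr true) p

/-- The linear form that reads the number of the control state. -/
def control (D : ℕ) : Coord D → ℕ := Pi.single (.inr false) 1

theorem reg_dotProduct {D i : ℕ} (hi : i < D) (σ : State) (p : ℕ) :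
    reg D i ⬝ᵥ coords D σ p = σ i := by
  have : ∀ k : Fin D, k.val = i ↔ k = ⟨i, hi⟩ := fun k => by simp [Fin.ext_iff]
  simp [dotProduct, reg, coords, this]

theorem const_dotProduct (D q : ℕ) (σ : State) (p : ℕ) : const D q ⬝ᵥ coords D σ p = q := by
  simp [const, coords]

theorem control_dotProduct (D : ℕ) (σ : State) (p : ℕ) : control D ⬝ᵥ coords D σ p = p := by
  simp [control, coords]

/-- The linear form that gives the contents of register `k` after an instruction. -/
def Instr.form (D : ℕ) : Instr → ℕ → Coord D → ℕ
  | test _ _, k => reg D k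
  | set i j, k => if k = i then reg D j else reg D k
  | zero i, k => if k = i then 0 else reg D k
  | inc i, k => if k = i then reg D i + const D 1 else reg D k

/-- The equality tests that express the guard of an instruction. -/
def Instr.tests (D : ℕ) : Instr → List ((Coord D → ℕ) × (Coord D → ℕ))
  | test i j => [(reg D i, reg D j)]
  | _ => []

/-- The rule that executes the instruction `o` in the control state number `p` and then goes to
the control state number `q`. -/
def Instr.toRule (D p : ℕ) (o : Instr) (q : ℕ) : LinearRule (Coord D) where
  form := Sum.elim (fun k => o.form D k) fun b => if b then const D 1 else const D q
  tests := (control D, const D p) :: o.tests D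

theorem Instr.toRule_apply {D : ℕ} {o : Instr} (ho : o.Below D) (p q p' : ℕ) (σ : State) :
    (o.toRule D p q).apply (coords D σ p') = coords D (o.update σ) q := by
  funext k
  rcases k with k | b
  · change o.form D k ⬝ᵥ coords D σ p' = o.update σ k
    cases o with
    | test i j => exact reg_dotProduct k.2 _ _
    | set i j =>
      simp only [form, update, Function.update_apply]
      split_ifs
      · exact reg_dotProduct ho.2 _ _
      · exact reg_dotProduct k.2 _ _
    | zero i =>
      simp only [form, update, Function.update_apply]
      split_ifs
      · simp
      · exact reg_dotProduct k.2 _ _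
    | inc i =>
      simp only [form, update, Function.update_apply]
      split_ifs
      · rw [add_dotProduct, const_dotProduct, reg_dotProduct ho]
      · exact reg_dotProduct k.2 _ _
  · cases b
    · exact const_dotProduct _ _ _ _
    · exact const_dotProduct _ _ _ _

theorem Instr.toRule_valid {D : ℕ} {o : Instr} (ho : o.Below D) (p q p' : ℕ) (σ : State) :
    (o.toRule D p q).Valid (coords D σ p') ↔ p' = p ∧ o.Guard σ := by
  simp only [LinearRule.Valid, toRule, List.forall_mem_cons, control_dotProduct, const_dotProduct]
  refine and_congr_right fun _ => ?_
  cases o with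
  | test i j => simp [tests, Guard, reg_dotProduct ho.1, reg_dotProduct ho.2]
  | _ => simp [tests, Guard]

theorem Instr.toRule_apply_one {D : ℕ} (o : Instr) (p q : ℕ) (x : Coord D → ℕ) :
    (o.toRule D p q).apply x (.inr true) = x (.inr true) := by
  simp [LinearRule.apply, toRule, const]

/-- Execution of a loop program is simulated by finitely many linear rules. A last rule `r` tests
that the final control state has been reached. -/
theorem exists_linearRules (P : Prog) : ∃ (D p : ℕ) (r : LinearRule (Coord D))
    (l : List (LinearRule (Coord D))),
    (∀ r' ∈ r :: l, ∀ x, r'.apply x (.inr true) = x (.inr true)) ∧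
    ∀ σ, (∃ τ, P.Rel σ τ) ↔ ∃ w : List (LinearRule (Coord D)), (∀ r' ∈ w, r' ∈ l) ∧
      LinearRule.ValidRun (w ++ [r]) (coords D σ p) := by
  set C := controls P [] with hC
  obtain ⟨num, hnum⟩ : ∃ num : List Prog → ℕ, Set.InjOn num {c | c ∈ [] :: C} :=
    Set.countable_iff_exists_injOn.1 (List.finite_toSet _).countable
  set E : List (List Prog × Instr × List Prog) := C.flatMap fun c => (edges c).map fun e => (c, e)
    with hE
  have mem_E : ∀ {c e}, (c, e) ∈ E ↔ c ∈ C ∧ e ∈ edges c := by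
    intro c e
    simp only [hE, List.mem_flatMap, List.mem_map, Prod.mk.injEq]
    constructor
    · rintro ⟨_, h, _, h', rfl, rfl⟩
      exact ⟨h, h'⟩
    · exact fun ⟨h, h'⟩ => ⟨_, h, _, h', rfl, rfl⟩
  obtain ⟨D, hD⟩ := exists_below_of_list (.test 0 0 :: E.map fun e => e.2.1)
  rw [List.forall_mem_cons, List.forall_mem_map] at hD
  refine ⟨D, num [P], Instr.toRule D (num []) (.test 0 0) (num []),
    E.map fun e => Instr.toRule D (num e.1) e.2.1 (num e.2.2), ?_, fun σ => ?_⟩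
  · rw [List.forall_mem_cons, List.forall_mem_map]
    exact ⟨fun x => Instr.toRule_apply_one _ _ _ x, fun e _ x => Instr.toRule_apply_one _ _ _ x⟩
  have hedge : ∀ {c e}, c ∈ [] :: C → e ∈ edges c → c ∈ C ∧ e.2 ∈ [] :: C := by
    intro c e hc he
    rcases List.mem_cons.1 hc with rfl | hc
    · simp [edges] at he
    · refine ⟨hc, ?_⟩
      rcases mem_controls_of_edge hc he with h | h
      · exact List.mem_cons_of_mem _ h
      · simp [h]
  have hP : [P] ∈ [] :: C := List.mem_cons_of_mem _ (cons_mem_controls P [])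
  simp only [rel_iff_steps, LinearRule.validRun_append]
  constructor
  · rintro ⟨τ, h⟩
    have key : ∀ b, Relation.ReflTransGen Step ([P], σ) b → b.1 ∈ [] :: C ∧
        ∃ w : List (LinearRule (Coord D)),
          (∀ r' ∈ w, r' ∈ E.map fun e => Instr.toRule D (num e.1) e.2.1 (num e.2.2)) ∧
          LinearRule.ValidRun w (coords D σ (num [P])) ∧
          LinearRule.run w (coords D σ (num [P])) = coords D b.2 (num b.1) := by
      intro b hb
      induction hb with
      | refl => exact ⟨hP, [], by simp, trivial, rfl⟩
      | @tail a b _ hs ih =>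
        obtain ⟨ha, w, h₁, h₂, h₃⟩ := ih
        obtain ⟨e, he, hg, rfl⟩ := hs
        obtain ⟨haC, heC⟩ := hedge ha he
        have hmem := mem_E.2 ⟨haC, he⟩
        refine ⟨heC, w ++ [Instr.toRule D (num a.1) e.1 (num e.2)], ?_, ?_, ?_⟩
        · intro r' hr'
          rcases List.mem_append.1 hr' with hr' | hr'
          · exact h₁ r' hr'
          · rw [List.mem_singleton.1 hr']
            exact List.mem_map.2 ⟨_, hmem, rfl⟩
        · rw [LinearRule.validRun_append, h₃]
          exact ⟨h₂, (Instr.toRule_valid (hD.2 _ hmem) _ _ _ _).2 ⟨rfl, hg⟩, trivial⟩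
        · rw [LinearRule.run_append, h₃]
          exact Instr.toRule_apply (hD.2 _ hmem) _ _ _ _
    obtain ⟨-, w, h₁, h₂, h₃⟩ := key _ h
    refine ⟨w, h₁, h₂, ?_⟩
    rw [h₃]
    exact ⟨(Instr.toRule_valid hD.1 _ _ _ _).2 ⟨rfl, rfl⟩, trivial⟩
  · rintro ⟨w, h₁, h₂, h₃⟩
    have key : ∀ w : List (LinearRule (Coord D)),
        (∀ r' ∈ w, r' ∈ E.map fun e => Instr.toRule D (num e.1) e.2.1 (num e.2.2)) →
        ∀ a : List Prog × State, a.1 ∈ [] :: C →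
        LinearRule.ValidRun w (coords D a.2 (num a.1)) →
        ∃ b, Relation.ReflTransGen Step a b ∧ b.1 ∈ [] :: C ∧
          LinearRule.run w (coords D a.2 (num a.1)) = coords D b.2 (num b.1) := by
      intro w
      induction w with
      | nil => exact fun _ a ha _ => ⟨a, .refl, ha, rfl⟩
      | cons r w ih =>
        rintro hw a ha ⟨hv, hv'⟩
        rw [List.forall_mem_cons, List.mem_map] at hw
        obtain ⟨⟨⟨c, e⟩, he, rfl⟩, hw⟩ := hw
        have hcE := mem_E.1 he
        obtain ⟨hn, hg⟩ := (Instr.toRule_valid (hD.2 _ he) _ _ _ _).1 hv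
        obtain rfl : a.1 = c := hnum ha (List.mem_cons_of_mem _ hcE.1) hn
        rw [Instr.toRule_apply (hD.2 _ he)] at hv'
        obtain ⟨b, hb, hbC, hrun⟩ := ih hw (e.2, e.1.update a.2) (hedge ha hcE.2).2 hv'
        refine ⟨b, .head ⟨e, hcE.2, hg, rfl⟩ hb, hbC, ?_⟩
        rw [← hrun, LinearRule.run, Instr.toRule_apply (hD.2 _ he)]
    obtain ⟨⟨c, τ⟩, hb, hbC, hrun⟩ := key w h₁ ([P], σ) hP h₂
    rw [hrun] at h₃
    obtain rfl : c = [] := hnum hbC (by simp) ((Instr.toRule_valid hD.1 _ _ _ _).1 h₃.1).1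
    exact ⟨τ, hb⟩

end LoopProgram

/-! ### Comparing two entries by synchronization -/

/-- All entries outside one column vanish, and the entries of that column have the same nonzero
value. -/
def HasConstantColumn {T K : Type*} [Zero K] [DecidableEq T] (A : Matrix T T K) : Prop :=
  ∃ (i : T) (c : K), c ≠ 0 ∧ ∀ j k, A j k = if k = i then c else 0

namespace SyncGadget

variable {ι : Type} [Fintype ι]

/-- The index set of the gadget: two copies of `ι` and a final index. -/
abbrev Index (ι : Type) := ι ⊕ ι ⊕ Unit

/-- A row vector in the first copy. -/
def left (v : ι → ℕ) : Index ι → ℕ := Sum.elim v 0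

/-- A row vector in the second copy. -/
def right (v : ι → ℕ) : Index ι → ℕ := Sum.elim 0 (Sum.elim v 0)

/-- A row vector at the final index. -/
def final (c : ℕ) : Index ι → ℕ := Sum.elim 0 (Sum.elim 0 fun _ => c)

/-- The matrix that starts with the vector `u`, each copy being kept apart. -/
def start (u : ι → ℕ) : Matrix (Index ι) (Index ι) ℕ :=
  .of (Sum.elim (fun _ => left u) (Sum.elim (fun _ => right u) fun _ => left u))

/-- The matrix `M` on both copies. -/
def body (M : Matrix ι ι ℕ) : Matrix (Index ι) (Index ι) ℕ :=
  .of (Sum.elim (fun i => left (M i)) (Sum.elim (fun i => right (M i)) 0))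

/-- The matrix that moves to the final index, by `α` on the first copy and by `β` on the second
one. -/
def finish (α β : ι → ℕ) : Matrix (Index ι) (Index ι) ℕ :=
  .of (Sum.elim (fun i => final (α i)) (Sum.elim (fun i => final (β i)) 0))

theorem left_vecMul_start (u v : ι → ℕ) : left v ᵥ* start u = left ((∑ i, v i) • u) := by
  funext k
  rcases k with k | k | k <;>
    simp [vecMul, dotProduct, left, right, start, Finset.sum_mul]

theorem right_vecMul_start (u v : ι → ℕ) : right v ᵥ* start u = right ((∑ i, v i) • u) := by
  funext k
  rcases k with k | k | k <;>
    simp [vecMul, dotProduct, left, right, start, Finset.sum_mul]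

theorem final_vecMul_start (u : ι → ℕ) (c : ℕ) : final c ᵥ* start u = left (c • u) := by
  funext k
  rcases k with k | k | k <;>
    simp [vecMul, dotProduct, left, final, start]

theorem left_vecMul_body (M : Matrix ι ι ℕ) (v : ι → ℕ) : left v ᵥ* body M = left (v ᵥ* M) := by
  funext k
  rcases k with k | k | k <;>
    simp [vecMul, dotProduct, left, right, body]

theorem right_vecMul_body (M : Matrix ι ι ℕ) (v : ι → ℕ) :
    right v ᵥ* body M = right (v ᵥ* M) := by
  funext k
  rcases k with k | k | k <;>
    simp [vecMul, dotProduct, left, right, body]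

theorem final_vecMul_body (M : Matrix ι ι ℕ) (c : ℕ) : final c ᵥ* body M = 0 := by
  funext k
  simp [vecMul, dotProduct, final, body]

theorem left_vecMul_finish (α β v : ι → ℕ) : left v ᵥ* finish α β = final (v ⬝ᵥ α) := by
  funext k
  rcases k with k | k | k <;>
    simp [vecMul, dotProduct, left, final, finish]

theorem right_vecMul_finish (α β v : ι → ℕ) : right v ᵥ* finish α β = final (v ⬝ᵥ β) := by
  funext k
  rcases k with k | k | k <;>
    simp [vecMul, dotProduct, right, final, finish]

theorem final_vecMul_finish (α β : ι → ℕ) (c : ℕ) : final c ᵥ* finish α β = 0 := by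
  funext k
  simp [vecMul, dotProduct, final, finish]

variable [DecidableEq ι]

/-- While the word is read, the rows that come from the two copies are proportional to
`u ᵥ* w.prod` with the same factor, and live in different copies; they can become equal only
by means of `finish`, and from then on their quotient does not change. -/
theorem exists_of_vecMul_eq {u α β : ι → ℕ} {S : Set (Matrix ι ι ℕ)} {i : Index ι} {c : ℕ}
    (hc : c ≠ 0) (W : List (Matrix (Index ι) (Index ι) ℕ))
    (hW : ∀ A ∈ W, A = start u ∨ A = finish α β ∨ ∃ M ∈ S, A = body M) (t : ℕ)
    (w : List (Matrix ι ι ℕ)) (hw : ∀ M ∈ w, M ∈ S)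
    (hl : (left (t • (u ᵥ* w.prod)) ᵥ* W.prod) i = c)
    (hr : (right (t • (u ᵥ* w.prod)) ᵥ* W.prod) i = c) :
    ∃ w : List (Matrix ι ι ℕ), (∀ M ∈ w, M ∈ S) ∧ u ᵥ* w.prod ⬝ᵥ α = u ᵥ* w.prod ⬝ᵥ β := by
  induction W generalizing t w with
  | nil =>
    rcases i with i | i | i <;> simp [left, right] at hl hr <;> omega
  | cons A W ih =>
    rw [List.forall_mem_cons] at hW
    rw [List.prod_cons, ← vecMul_vecMul] at hl hr
    obtain ⟨rfl | rfl | ⟨M, hM, rfl⟩, hW⟩ := hW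
    · rw [left_vecMul_start] at hl
      rw [right_vecMul_start] at hr
      exact ih hW _ [] (by simp) (by rwa [List.prod_nil, vecMul_one])
        (by rwa [List.prod_nil, vecMul_one])
    · refine ⟨w, hw, ?_⟩
      have hfin : ∀ a : ℕ, final a = a • (final 1 : Index ι → ℕ) := fun a => by
        funext k
        rcases k with k | k | k <;> simp [final]
      rw [left_vecMul_finish, hfin, smul_vecMul, smul_dotProduct, Pi.smul_apply, smul_eq_mul,
        smul_eq_mul] at hl
      rw [right_vecMul_finish, hfin, smul_vecMul, smul_dotProduct, Pi.smul_apply, smul_eq_mul,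
        smul_eq_mul, ← hl] at hr
      rw [← hl] at hc
      have h1 := right_ne_zero_of_mul hc
      have h2 := left_ne_zero_of_mul (left_ne_zero_of_mul hc)
      exact mul_left_cancel₀ h2 (mul_right_cancel₀ h1 hr.symm)
    · rw [left_vecMul_body, smul_vecMul, vecMul_vecMul] at hl
      rw [right_vecMul_body, smul_vecMul, vecMul_vecMul] at hr
      refine ih hW t (w ++ [M]) ?_ (by simpa using hl) (by simpa using hr)
      simpa [or_imp, forall_and] using ⟨hw, hM⟩

/-- If the two values are never zero, the gadget is synchronizable exactly if some product of
matrices in `S` makes them equal. -/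
theorem exists_hasConstantColumn_iff [Nonempty ι] {u α β : ι → ℕ} {S : Set (Matrix ι ι ℕ)}
    (hpos : ∀ w : List (Matrix ι ι ℕ), (∀ M ∈ w, M ∈ S) → u ᵥ* w.prod ⬝ᵥ α ≠ 0) :
    (∃ W : List (Matrix (Index ι) (Index ι) ℕ), W ≠ [] ∧
      (∀ A ∈ W, A = start u ∨ A = finish α β ∨ ∃ M ∈ S, A = body M) ∧
      HasConstantColumn W.prod) ↔
    ∃ w : List (Matrix ι ι ℕ), (∀ M ∈ w, M ∈ S) ∧ u ᵥ* w.prod ⬝ᵥ α = u ᵥ* w.prod ⬝ᵥ β := by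
  constructor
  · rintro ⟨W, hne, hW, i, c, hc, h⟩
    obtain ⟨A, W, rfl⟩ := List.exists_cons_of_ne_nil hne
    have hrow : ∀ j, (Pi.single j 1 ᵥ* (A :: W).prod) i = c := fun j => by
      rw [single_one_vecMul]
      exact (h j i).trans (if_pos rfl)
    rw [List.forall_mem_cons] at hW
    simp only [List.prod_cons, ← vecMul_vecMul] at hrow
    have hfinal : (Pi.single (.inr (.inr ())) 1 : Index ι → ℕ) = final 1 := by
      funext k
      rcases k with k | k | k <;> simp [final]
    obtain ⟨j₀⟩ := ‹Nonempty ι›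
    have hright : (Pi.single (.inr (.inl j₀)) 1 : Index ι → ℕ) = right (Pi.single j₀ 1) := by
      funext k
      rcases k with k | k | k <;> simp [right, Pi.single_apply]
    -- The row of the final index is killed by every first factor but `start u`. After that factor,
    -- this row lives in the first copy, and a row of the second copy stays in the second one.
    have h₁ := hrow (.inr (.inr ()))
    have h₂ := hrow (.inr (.inl j₀))
    rw [hfinal] at h₁
    rw [hright] at h₂
    obtain ⟨rfl | rfl | ⟨M, -, rfl⟩, hW⟩ := hW
    · rw [final_vecMul_start] at h₁
      rw [right_vecMul_start, Finset.sum_pi_single'] at h₂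
      exact exists_of_vecMul_eq hc W hW 1 [] (by simp) (by simpa using h₁) (by simpa using h₂)
    · rw [final_vecMul_finish, zero_vecMul] at h₁
      exact absurd h₁.symm hc
    · rw [final_vecMul_body, zero_vecMul] at h₁
      exact absurd h₁.symm hc
  · rintro ⟨w, hw, h⟩
    refine ⟨start u :: (w.map body ++ [finish α β]), by simp, ?_, .inr (.inr ()),
      u ᵥ* w.prod ⬝ᵥ α, hpos w hw, ?_⟩
    · intro A hA
      simp only [List.mem_cons, List.mem_append, List.mem_map, List.not_mem_nil, or_false] at hA
      rcases hA with rfl | ⟨M, hM, rfl⟩ | rfl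
      · exact .inl rfl
      · exact .inr (.inr ⟨M, hw M hM, rfl⟩)
      · exact .inr (.inl rfl)
    have hl : ∀ v, left v ᵥ* (w.map body).prod = left (v ᵥ* w.prod) := by
      clear hw h
      induction w with
      | nil => simp
      | cons M w ih =>
        intro v
        simp only [List.map_cons, List.prod_cons, ← vecMul_vecMul, left_vecMul_body, ih]
    have hr : ∀ v, right v ᵥ* (w.map body).prod = right (v ᵥ* w.prod) := by
      clear hw h hl
      induction w with
      | nil => simp
      | cons M w ih =>
        intro v
        simp only [List.map_cons, List.prod_cons, ← vecMul_vecMul, right_vecMul_body, ih]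
    have hstart : ∀ j, start u j = left u ∨ start u j = right u := by
      rintro (j | j | j)
      · exact .inl rfl
      · exact .inr rfl
      · exact .inl rfl
    have hrow : ∀ j, (start u :: (w.map body ++ [finish α β])).prod j =
        final (u ᵥ* w.prod ⬝ᵥ α) := by
      intro j
      rw [List.prod_cons, mul_apply_eq_vecMul, List.prod_append, List.prod_singleton,
        ← vecMul_vecMul]
      rcases hstart j with hj | hj
      · rw [hj, hl, left_vecMul_finish]
      · rw [hj, hr, right_vecMul_finish, h]
    intro j k
    rw [hrow]
    rcases k with k | k | k <;> simp [final]

end SyncGadget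

/-! ### Undecidability of synchronization -/

theorem List.exists_map_eq_of_forall_mem_image {α β : Type*} {g : α → β} {S : Set α}
    {w : List β} (h : ∀ b ∈ w, b ∈ g '' S) : ∃ v : List α, (∀ a ∈ v, a ∈ S) ∧ v.map g = w := by
  induction w with
  | nil => exact ⟨[], by simp⟩
  | cons b w ih =>
    rw [List.forall_mem_cons] at h
    obtain ⟨⟨a, ha, rfl⟩, h⟩ := h
    obtain ⟨v, hv, rfl⟩ := ih h
    exact ⟨a :: v, by simpa using ⟨ha, hv⟩, rfl⟩

/-- The domain of a partial recursive function reduces to synchronization over `ℕ`. The sizes of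
the matrices, and all matrices but one, do not depend on the input. -/
theorem exists_matrices_of_partrec {f : ℕ →. ℕ} (hf : Partrec f) :
    ∃ (T : Type) (_ : Fintype T) (_ : DecidableEq T) (_ : Nonempty T) (A : ℕ → Matrix T T ℕ)
      (L : List (Matrix T T ℕ)), (∀ i j, Primrec fun n => A n i j) ∧
      ∀ n, (f n).Dom ↔ ∃ W : List (Matrix T T ℕ), W ≠ [] ∧ (∀ B ∈ W, B ∈ A n :: L) ∧
        HasConstantColumn W.prod := by
  obtain ⟨P, hP⟩ := LoopProgram.exists_prog_of_partrec hf
  obtain ⟨D, p, r, l, hone, hl⟩ := LoopProgram.exists_linearRules P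
  set x : ℕ → LoopProgram.Coord D → ℕ :=
    fun n => LoopProgram.coords D (fun i => if i = 0 then n else 0) p with hx
  let one : (LoopProgram.Coord D × LoopProgram.Coord D) ⊕ Bool := .inl (.inr true, .inr true)
  -- Each accumulator is read together with the constant coordinate `1 * 1`, so that the values
  -- to be compared are nonzero.
  let acc (b : Bool) : (LoopProgram.Coord D × LoopProgram.Coord D) ⊕ Bool → ℕ :=
    Pi.single (.inr b) 1 + Pi.single one 1
  let u n := LinearRule.vec (x n) 0 0
  let α := r.toMatrix *ᵥ acc true
  let β := r.toMatrix *ᵥ acc false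
  let S : Set (Matrix _ _ ℕ) := LinearRule.toMatrix '' {r' | r' ∈ l}
  have hrun_one : ∀ (w : List (LinearRule (LoopProgram.Coord D))), (∀ r' ∈ w, r' ∈ r :: l) →
      ∀ y, LinearRule.run w y (.inr true) = y (.inr true) := by
    intro w
    induction w with
    | nil => exact fun _ _ => rfl
    | cons r' w ih =>
      intro hw y
      rw [List.forall_mem_cons] at hw
      rw [LinearRule.run, ih hw.2, hone r' hw.1]
  have hvalue : ∀ (w : List (LinearRule (LoopProgram.Coord D))), (∀ r' ∈ w, r' ∈ l) → ∀ n b,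
      u n ᵥ* (w.map LinearRule.toMatrix).prod ⬝ᵥ (r.toMatrix *ᵥ acc b) =
        (if b then LinearRule.runSquares (w ++ [r]) (x n)
          else LinearRule.runCross (w ++ [r]) (x n)) + 1 := by
    intro w hw n b
    have hprod : u n ᵥ* (w.map LinearRule.toMatrix).prod ᵥ* r.toMatrix =
        u n ᵥ* ((w ++ [r]).map LinearRule.toMatrix).prod := by
      simp [vecMul_vecMul]
    have h1 := hrun_one (w ++ [r]) (by
      intro r' hr'
      rcases List.mem_append.1 hr' with h | h
      · exact List.mem_cons_of_mem _ (hw r' h)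
      · simp [List.mem_singleton.1 h]) (x n)
    have hx1 : x n (.inr true) = 1 := rfl
    rw [dotProduct_mulVec, hprod, LinearRule.vec_vecMul_prod, dotProduct_add,
      dotProduct_single_one, dotProduct_single_one]
    simp [LinearRule.vec, one, h1, hx1]
  have hwords : ∀ w : List (Matrix _ _ ℕ), (∀ M ∈ w, M ∈ S) →
      ∃ v : List (LinearRule (LoopProgram.Coord D)), (∀ r' ∈ v, r' ∈ l) ∧
        v.map LinearRule.toMatrix = w := fun w hw =>
    List.exists_map_eq_of_forall_mem_image hw
  have : Nonempty ((LoopProgram.Coord D × LoopProgram.Coord D) ⊕ Bool) := ⟨one⟩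
  refine ⟨SyncGadget.Index ((LoopProgram.Coord D × LoopProgram.Coord D) ⊕ Bool), inferInstance,
    instDecidableEqSum, inferInstance, fun n => SyncGadget.start (u n),
    SyncGadget.finish α β :: l.map fun r' => SyncGadget.body r'.toMatrix, ?_, fun n => ?_⟩
  · have hxp : ∀ k, Primrec fun n => x n k := by
      rintro (k | b)
      · by_cases hk : k.val = 0
        · exact Primrec.id.of_eq fun n => by simp [hx, LoopProgram.coords, hk]
        · exact (Primrec.const 0).of_eq fun n => by simp [hx, LoopProgram.coords, hk]
      · exact Primrec.const _
    have hup : ∀ k, Primrec fun n => u n k := by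
      rintro (k | b)
      · exact Primrec.nat_mul.comp (hxp k.1) (hxp k.2)
      · exact Primrec.const _
    rintro (i | i | i) (j | j | j)
    all_goals first | exact hup j | exact Primrec.const 0
  · have hmem : ∀ B, B ∈ SyncGadget.start (u n) :: SyncGadget.finish α β ::
        (l.map fun r' => SyncGadget.body r'.toMatrix) ↔
        B = SyncGadget.start (u n) ∨ B = SyncGadget.finish α β ∨
          ∃ M ∈ S, B = SyncGadget.body M := by
      intro B
      simp [S, eq_comm]
    simp only [hmem]
    rw [SyncGadget.exists_hasConstantColumn_iff, hP, hl]
    · constructor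
      · rintro ⟨w, hw, hv⟩
        refine ⟨w.map LinearRule.toMatrix, ?_, ?_⟩
        · rw [List.forall_mem_map]
          exact fun r' hr' => ⟨r', hw r' hr', rfl⟩
        · rw [hvalue w hw n true, hvalue w hw n false]
          simpa using ((LinearRule.runCross_eq_runSquares_iff _ _).2 hv).symm
      · rintro ⟨w, hw, h⟩
        obtain ⟨v, hv, rfl⟩ := hwords w hw
        rw [hvalue v hv n true, hvalue v hv n false] at h
        exact ⟨v, hv, (LinearRule.runCross_eq_runSquares_iff _ _).1 (by simpa using h.symm)⟩
    · intro w hw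
      obtain ⟨v, hv, rfl⟩ := hwords w hw
      rw [hvalue v hv n true]
      exact Nat.succ_ne_zero _

theorem hasConstantColumn_iff {T K : Type*} [Zero K] [DecidableEq T] [Nonempty T]
    {A : Matrix T T K} :
    HasConstantColumn A ↔ ∃ i, (∀ j k, A j k ≠ 0 ↔ k = i) ∧ ∀ j j', A j i = A j' i := by
  constructor
  · rintro ⟨i, c, hc, h⟩
    exact ⟨i, fun j k => by simp [h, hc], fun j j' => by simp [h]⟩
  · rintro ⟨i, h, h'⟩
    obtain ⟨j₀⟩ := ‹Nonempty T›
    refine ⟨i, A j₀ i, (h _ _).2 rfl, fun j k => ?_⟩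
    split_ifs with hk
    · rw [hk, h' j j₀]
    · exact not_not.1 fun hn => hk ((h _ _).1 hn)

theorem isSynchronizing_map_submatrix_iff {T K : Type*} [Semiring K] [DecidableEq T] [Nonempty T]
    (hK : Function.Injective (Nat.cast : ℕ → K)) {N : ℕ} (e : Fin N ≃ T) (A : Matrix T T ℕ) :
    IsSynchronizing (.of fun i j => (A (e i) (e j) : K) : Matrix (Fin N) (Fin N) K) ↔
      HasConstantColumn A := by
  have h0 : ∀ m : ℕ, (m : K) = 0 ↔ m = 0 := fun m => by
    rw [← Nat.cast_zero, hK.eq_iff]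
  -- All indices on the right are rewritten as values of `e`.
  simp only [hasConstantColumn_iff, IsSynchronizing, IsLocationSynchronizingAt, of_apply, ne_eq,
    h0, hK.eq_iff, ← e.forall_congr_right (q := fun _ => _), ← e.exists_congr_right,
    e.apply_eq_iff_eq]

/-- A decision procedure for synchronization over `K`, run on the instances that come from a
universal function, would decide the halting problem. -/
theorem not_syncDecidable {K α : Type*} [Semiring K] [Primcodable α]
    (hK : Function.Injective (Nat.cast : ℕ → K)) (ρ : α →. K) (hρ : NamesNaturals ρ) :
    ¬ SyncDecidable ρ := by
  rintro ⟨F, hF, hF'⟩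
  obtain ⟨c, hc, hcρ⟩ := hρ
  have hcρ' : ∀ m : ℕ, ρ (c m) = Part.some (m : K) := fun m =>
    Part.eq_some_iff.2 (by simpa using hcρ m)
  -- A universal function: its domain is the halting set of all programs on input `0`.
  have hf : Partrec fun k : ℕ =>
      Nat.Partrec.Code.eval (Denumerable.ofNat Nat.Partrec.Code k) 0 :=
    Nat.Partrec.Code.eval_part.comp (Computable.ofNat _) (Computable.const 0)
  obtain ⟨T, _, _, _, A, L, hA, hL⟩ := exists_matrices_of_partrec hf
  let e := (Fintype.equivFin T).symm
  let name : Matrix T T ℕ → Matrix (Fin (Fintype.card T)) (Fin (Fintype.card T)) α :=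
    fun B => .of fun i j => c (B (e i) (e j))
  let Φ : Matrix T T ℕ →* Matrix (Fin (Fintype.card T)) (Fin (Fintype.card T)) K :=
    (Nat.castRingHom K).mapMatrix.toMonoidHom.comp
      (reindexAlgEquiv ℕ ℕ e.symm).toRingEquiv.toRingHom.toMonoidHom
  have hΦ : ∀ B, Φ B = .of fun i j => (B (e i) (e j) : K) := fun B => rfl
  have hname : ∀ M i j, ρ (name M i j) = Part.some (M (e i) (e j) : K) := fun _ _ _ => hcρ' _
  have hden : ∀ n, denotedMatrices ρ ((A n :: L).map name) = Φ '' {B | B ∈ A n :: L} := by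
    intro n
    ext B
    simp only [denotedMatrices, Set.mem_ofPred_eq, List.mem_map, Set.mem_image, hΦ]
    constructor
    · rintro ⟨_, ⟨M, hM, rfl⟩, h⟩
      refine ⟨M, hM, ?_⟩
      ext i j
      have := h i j
      rw [hname, Part.mem_some_iff] at this
      exact this.symm
    · rintro ⟨M, hM, rfl⟩
      exact ⟨_, ⟨M, hM, rfl⟩, fun i j => by rw [hname, of_apply, Part.mem_some_iff]⟩
  have hsync : ∀ n, IsSynchronizable (denotedMatrices ρ ((A n :: L).map name)) ↔
      (Nat.Partrec.Code.eval (Denumerable.ofNat Nat.Partrec.Code n) 0).Dom := by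
    intro n
    rw [hL, hden, IsSynchronizable]
    constructor
    · rintro ⟨W, hne, hW, h⟩
      obtain ⟨V, hV, rfl⟩ := List.exists_map_eq_of_forall_mem_image hW
      rw [← map_list_prod, hΦ, isSynchronizing_map_submatrix_iff hK] at h
      exact ⟨V, by simpa using hne, hV, h⟩
    · rintro ⟨V, hne, hV, h⟩
      refine ⟨V.map Φ, by simpa using hne, ?_, ?_⟩
      · rw [List.forall_mem_map]
        exact fun B hB => ⟨B, hV B hB, rfl⟩
      · rwa [← map_list_prod, hΦ, isSynchronizing_map_submatrix_iff hK]
  have hcomp : Computable fun n => instanceCode ((A n :: L).map name) := by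
    refine (Computable.const _).pair ?_
    simp only [List.map_cons]
    refine Computable.list_cons.comp ?_ (Computable.const _)
    exact Computable.list_ofFn fun i => Computable.list_ofFn fun j =>
      hc.comp (hA (e i) (e j)).to_comp
  have hdom : ∀ n, ∀ B ∈ (A n :: L).map name, ∀ i j, (ρ (B i j)).Dom := by
    intro n B hB i j
    obtain ⟨M, -, rfl⟩ := List.mem_map.1 hB
    rw [hname]
    trivial
  have hdec : ComputablePred fun n : ℕ =>
      (Nat.Partrec.Code.eval (Denumerable.ofNat Nat.Partrec.Code n) 0).Dom := by
    classical
    refine ⟨fun _ => Classical.propDecidable _, (hF.comp hcomp).of_eq fun n => ?_⟩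
    obtain ⟨h₁, h₂⟩ := hF' _ Fintype.card_pos _ (hdom n)
    rw [hsync] at h₂
    refine Part.eq_some_iff.2 ?_
    obtain ⟨b, hb⟩ := Part.dom_iff_mem.1 h₁
    rw [Part.eq_some_iff.2 hb, Part.mem_some_iff] at h₂ ⊢
    cases b <;> simpa using h₂
  refine ComputablePred.halting_problem 0 ?_
  obtain ⟨_, h⟩ := hdec
  refine ⟨fun _ => Classical.propDecidable _, (h.comp Computable.encode).of_eq fun k => ?_⟩
  simp

/-- A coincidence `m • 1 = n • 1` with `m < n` makes the multiples of `1` periodic from `m` on, so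
that those below `n • 1` are all of them. -/
theorem injective_cast_of_oneHasInfiniteOrder {K : Type*} [Semiring K]
    (h : OneHasInfiniteOrder K) : Function.Injective (Nat.cast : ℕ → K) := by
  by_contra hinj
  obtain ⟨m, n, hmn, hlt⟩ : ∃ m n : ℕ, (m : K) = n ∧ m < n := by
    simp only [Function.Injective, not_forall] at hinj
    obtain ⟨a, b, hab, hne⟩ := hinj
    rcases Nat.lt_or_gt_of_ne hne with hlt | hlt
    · exact ⟨a, b, hab, hlt⟩
    · exact ⟨b, a, hab.symm, hlt⟩
  refine h (((Set.finite_lt_nat n).image (Nat.cast : ℕ → K)).subset ?_)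
  rintro _ ⟨k, rfl⟩
  induction k using Nat.strong_induction_on with
  | _ k ih =>
    rcases lt_or_ge k n with hk | hk
    · exact ⟨k, hk, by simp⟩
    · have : ((k - n + m : ℕ) : K) = k := by
        rw [Nat.cast_add, hmn, ← Nat.cast_add, Nat.sub_add_cancel hk]
      simpa [← this] using ih (k - n + m) (by omega)

theorem oneHasInfiniteOrder_of_injective {K : Type*} [Semiring K] {φ : ℕ →+* K}
    (hφ : Function.Injective φ) : OneHasInfiniteOrder K := by
  refine (Set.infinite_range_of_injective hφ).mono ?_
  rintro _ ⟨n, rfl⟩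
  exact ⟨n, by simp⟩

theorem mainTheorem1 :
    ¬ SyncDecidable (PFun.id ℕ) ∧
    ∀ (K : Type*) [Semiring K],
      (OneHasInfiniteOrder K ↔ ∃ φ : ℕ →+* K, Function.Injective φ) ∧
      (OneHasInfiniteOrder K →
        ∀ (α : Type*) [Primcodable α] (ρ : α →. K), NamesNaturals ρ → ¬ SyncDecidable ρ) := by
  refine ⟨not_syncDecidable Nat.cast_injective _ ⟨id, Computable.id, fun m => ?_⟩,
    fun K _ => ⟨⟨fun h => ⟨Nat.castRingHom K, injective_cast_of_oneHasInfiniteOrder h⟩,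
      fun ⟨_, hφ⟩ => oneHasInfiniteOrder_of_injective hφ⟩, fun h α _ ρ hρ =>
      not_syncDecidable (injective_cast_of_oneHasInfiniteOrder h) ρ hρ⟩⟩
  simp [PFun.id]
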